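/- Let $n\ge 1$. All posets are finite and are counted up to isomorphism; all matrices are square with nonnegative integer entries. An interval order is a poset with no induced subposet isomorphic to $\mathbf 2+\mathbf 2$, the disjoint union of two $2$-element chains; a poset is self-dual if it is isomorphic to its dual. An upper-triangular matrix is a Fishburn matrix if each row and each column contains a nonzero entry, and a row-Fishburn matrix if each row contains a nonzero entry. The size of a matrix is the sum of its entries. A matrix $M$ of dimension $m$ is self-dual if $M_{i,j}=M_{m+1-j,\,m+1-i}$ for all $1\le i,j\le m$; its reduced size is $\sum_{i+j\le m+1}M_{i,j}$. The distinct strict down-sets $D(x)=\{y: y\prec x\}$ of an interval order $P$ form a chain $D_1\subset\dots\subset D_m$ and its distinct strict up-sets $U(x)=\{y: y\succ x\}$ form a chain $U_1\supset\dots\supset U_m$ of the same length $m$; the Fishburn matrix of $P$ is the $m\times m$ matrix whose entry $(i,j)$ is the number of $x\in P$ with $D(x)=D_i$ and $U(x)=U_j$. The reduced size of a self-dual interval order is the reduced size of its Fishburn matrix. Let $\mathcal I(n)$ be the set of self-dual interval orders of reduced size $n$ (up to isomorphism), $\mathcal M(n)$ the set of self-dual Fishburn matrices (of any dimension) of reduced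 size $n$, and $\mathcal{RM}(n)$ the set of row-Fishburn matrices (of any dimension) of size $n$. Then these three sets are finite and $$|\mathcal I(n)|=|\mathcal M(n)|=2\,|\mathcal{RM}(n)|.$$ -/

import Mathlib

namespace SelfDualIntervalOrder

/-! ### Square matrices of nonnegative integers

Matrices of dimension `m` are indexed by `Fin m`, so the 1-based row and column numbers of the
cell `(i, j)` are `i + 1` and `j + 1`. -/

section Matrices

variable {m : ℕ}

/-- All entries strictly below the main diagonal vanish. -/
def IsUpperTriangular (M : Matrix (Fin m) (Fin m) ℕ) : Prop :=
  ∀ i j, j < i → M i j = 0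

/-- The size of a matrix: the sum of all its entries. -/
def size (M : Matrix (Fin m) (Fin m) ℕ) : ℕ := ∑ i, ∑ j, M i j

/-- The dual matrix: reflection in the diagonal from bottom-left to top-right.
`Fin.rev` sends the 1-based index `i` to `m + 1 - i`. -/
def dual (M : Matrix (Fin m) (Fin m) ℕ) : Matrix (Fin m) (Fin m) ℕ :=
  Matrix.of fun i j => M j.rev i.rev

/-- Fishburn matrix: upper triangular, every row and every column has a nonzero entry. -/
def IsFishburn (M : Matrix (Fin m) (Fin m) ℕ) : Prop :=
  IsUpperTriangular M ∧ (∀ i, ∃ j, M i j ≠ 0) ∧ (∀ j, ∃ i, M i j ≠ 0)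

/-- Row-Fishburn matrix: upper triangular, every row has a nonzero entry. -/
def IsRowFishburn (M : Matrix (Fin m) (Fin m) ℕ) : Prop :=
  IsUpperTriangular M ∧ ∀ i, ∃ j, M i j ≠ 0

/-- The reduced size: the sum of the entries in the diagonal cells (1-based `i + j = m + 1`) and
in the NW-cells (1-based `i + j < m + 1`). -/
def reducedSize (M : Matrix (Fin m) (Fin m) ℕ) : ℕ :=
  ∑ i : Fin m, ∑ j : Fin m,
    if ((i : ℕ) + 1) + ((j : ℕ) + 1) ≤ m + 1 then M i j else 0

end Matrices

/-- The set `ℳ(n)` of self-dual Fishburn matrices (of any dimension) of reduced size `n`. -/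
def selfDualFishburnMatrices (n : ℕ) : Set (Σ m : ℕ, Matrix (Fin m) (Fin m) ℕ) :=
  {M | IsFishburn M.2 ∧ dual M.2 = M.2 ∧ reducedSize M.2 = n}

/-- The set `ℛℳ(n)` of row-Fishburn matrices (of any dimension) of size `n`. -/
def rowFishburnMatrices (n : ℕ) : Set (Σ m : ℕ, Matrix (Fin m) (Fin m) ℕ) :=
  {M | IsRowFishburn M.2 ∧ size M.2 = n}

/-! ### Interval orders -/

section Posets

variable (P : Type*) [PartialOrder P]

/-- Interval order: a poset with no induced subposet isomorphic to `2 + 2`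
(the order on `Fin 2 ⊕ Fin 2` is the disjoint union of two 2-element chains). -/
def IsIntervalOrder : Prop := IsEmpty ((Fin 2 ⊕ Fin 2) ↪o P)

/-- A poset is self-dual if it is isomorphic to its dual. -/
def IsSelfDual : Prop := Nonempty (P ≃o Pᵒᵈ)

/-- The collection of strict down-sets `D(x) = {y | y < x}`. -/
def downSets : Set (Set P) := Set.range fun x : P => Set.Iio x

/-- The collection of strict up-sets `U(x) = {y | x < y}`. -/
def upSets : Set (Set P) := Set.range fun x : P => Set.Ioi x

/-- The magnitude: the number of distinct strict down-sets. -/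
noncomputable def magnitude : ℕ := (downSets P).ncard

variable {P}

/-- The (1-based) level of `x`: when the strict down-sets form a chain `D₁ ⊂ D₂ ⊂ ⋯ ⊂ D_m`,
it is the `i` with `D(x) = D_i`, since `D₁, …, D_i` are those contained in `D_i`. -/
noncomputable def level (x : P) : ℕ := {D ∈ downSets P | D ⊆ Set.Iio x}.ncard

/-- The (1-based) up-level of `x`: when the strict up-sets form a chain `U₁ ⊃ U₂ ⊃ ⋯ ⊃ U_m`,
it is the `i` with `U(x) = U_i`, since `U₁, …, U_i` are those containing `U_i`. -/
noncomputable def upLevel (x : P) : ℕ := {U ∈ upSets P | Set.Ioi x ⊆ U}.ncard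

variable (P)

/-- The matrix that Fishburn's bijection assigns to an interval order: its (1-based) entry `(i, j)`
is the number of elements of level `i` and up-level `j`. -/
noncomputable def fishburnMatrix : Matrix (Fin (magnitude P)) (Fin (magnitude P)) ℕ :=
  Matrix.of fun i j => {x : P | level x = (i : ℕ) + 1 ∧ upLevel x = (j : ℕ) + 1}.ncard

/-- The reduced size of a (self-dual interval) order is that of its Fishburn matrix. -/
noncomputable def orderReducedSize : ℕ := reducedSize (fishburnMatrix P)

end Posets

/-- Isomorphism of finite posets. -/
def isoSetoid : Setoid FinPartOrd.{0} where
  r P Q := Nonempty (P ≃o Q)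
  iseqv :=
    { refl := fun P => ⟨OrderIso.refl P⟩
      symm := fun ⟨e⟩ => ⟨e.symm⟩
      trans := fun ⟨e⟩ ⟨f⟩ => ⟨e.trans f⟩ }

/-- The set `ℐ(n)` of self-dual interval orders of reduced size `n`: finite posets, counted up to
isomorphism. -/
def selfDualIntervalOrders (n : ℕ) : Set (Quotient isoSetoid) :=
  Quotient.mk isoSetoid ''
    {P : FinPartOrd.{0} | IsIntervalOrder P ∧ IsSelfDual P ∧ orderReducedSize P = n}

end SelfDualIntervalOrder

namespace SelfDualIntervalOrder

/-! A finite interval order has exactly one representation by integer intervals in which every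
number of `[1, m]` occurs both as a left and as a right endpoint; the endpoints are `level` and
`upLevel`. Hence the Fishburn matrix is a complete isomorphism invariant, every Fishburn matrix
occurs, and reversing the line turns poset duality into matrix duality
(`IsIntervalOrder.isSelfDual_iff`, `selfDualIntervalOrders_eq_image`).

A self-dual matrix of dimension `2k + e`, `e ≤ 1`, is determined by its cells on or above both
diagonals, whose sum is the reduced size. Being Fishburn means that the first `k + e` columns of
this half are nonzero and that `k` hooks are nonzero (`isFishburn_selfDualExtension_iff`).
Inclusion-exclusion over the vanishing hooks turns the generating function into the value at `0` of
`T^k h`, with `g = 1 + X + ⋯ + X^n`, `(T h)(r) = g^(r+1) (g^(r+1) - 1) h(r+1) - (g^r - 1) h(r)` and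
`h(r) = (g^(r+1) - 1)^e`.

Modulo a high power of `X`, `H = ∑ T^k h` solves `H = h + T H`, that is, `g^r H(r) = h(r) + (g^(r+1)
- 1) g^(r+1) H(r+1)`. Unrolling gives `H(0) = ∑ p_r h(r)` with `p_r = ∏_{j ≤ r} (g^j - 1)`, and
`p_r` also counts the row-Fishburn matrices of dimension `r`. For `e = 0` this is `∑ p_r`, for `e =
1` it is `∑ p_(r+1)`. They differ by `p_0 = 1`, so for `n ≥ 1` even and odd dimensions each
contribute `|RM(n)|`. -/

/-- A representation of a poset by integer intervals `[l x, u x]` in which every integer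
of `[1, m]` is both a left endpoint and a right endpoint. -/
structure IsCanonicalRep (P : Type*) [PartialOrder P] (m : ℕ) (l u : P → ℕ) : Prop where
  lt_iff : ∀ x y, x < y ↔ u x < l y
  range_left : Set.range l = Set.Icc 1 m
  range_right : Set.range u = Set.Icc 1 m

/-! ### Rigidity of canonical interval representations -/

namespace IsCanonicalRep

variable {P Q : Type*} [PartialOrder P] [PartialOrder Q] {m : ℕ} {l u : P → ℕ} {l' u' : Q → ℕ}

lemma left_mem (h : IsCanonicalRep P m l u) (x : P) : l x ∈ Set.Icc 1 m :=
  h.range_left ▸ Set.mem_range_self x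

lemma right_mem (h : IsCanonicalRep P m l u) (x : P) : u x ∈ Set.Icc 1 m :=
  h.range_right ▸ Set.mem_range_self x

lemma exists_left (h : IsCanonicalRep P m l u) {a : ℕ} (ha : a ∈ Set.Icc 1 m) : ∃ x, l x = a :=
  h.range_left.superset ha

lemma exists_right (h : IsCanonicalRep P m l u) {a : ℕ} (ha : a ∈ Set.Icc 1 m) : ∃ x, u x = a :=
  h.range_right.superset ha

lemma left_le_right (h : IsCanonicalRep P m l u) (x : P) : l x ≤ u x :=
  not_lt.1 fun hx => lt_irrefl x ((h.lt_iff x x).2 hx)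

lemma isIntervalOrder (h : IsCanonicalRep P m l u) : IsIntervalOrder P := by
  refine ⟨fun f => ?_⟩
  have h1 : f (Sum.inl 0) < f (Sum.inl 1) := f.lt_iff_lt.2 (by simp)
  have h2 : f (Sum.inr 0) < f (Sum.inr 1) := f.lt_iff_lt.2 (by simp)
  have h3 : ¬ f (Sum.inl 0) < f (Sum.inr 1) := fun h => by simpa using f.lt_iff_lt.1 h
  have h4 : ¬ f (Sum.inr 0) < f (Sum.inl 1) := fun h => by simpa using f.lt_iff_lt.1 h
  rw [h.lt_iff] at h1 h2 h3 h4
  omega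

lemma downSets_eq (h : IsCanonicalRep P m l u) :
    downSets P = (fun a => {x | u x < a}) '' Set.Icc 1 m := by
  rw [← h.range_left, ← Set.range_comp]
  exact congrArg Set.range (funext fun x => Set.ext fun y => h.lt_iff y x)

lemma upSets_eq (h : IsCanonicalRep P m l u) :
    upSets P = (fun a => {x | a < l x}) '' Set.Icc 1 m := by
  rw [← h.range_right, ← Set.range_comp]
  exact congrArg Set.range (funext fun x => Set.ext fun y => h.lt_iff x y)

/-- Some interval ends at `b`; if `b < a`, it lies in the first set and not in the second. -/
lemma downSet_subset_iff (h : IsCanonicalRep P m l u) {a b : ℕ}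
    (hb : b ∈ Set.Icc 1 m) : {x | u x < a} ⊆ {x | u x < b} ↔ a ≤ b := by
  refine ⟨fun hab => not_lt.1 fun hlt => ?_, fun hab x hx => lt_of_lt_of_le hx hab⟩
  obtain ⟨x, hx⟩ := h.exists_right hb
  have := hab (show u x < a by omega)
  simp only [Set.mem_ofPred_eq] at this
  omega

lemma upSet_subset_iff (h : IsCanonicalRep P m l u) {a b : ℕ}
    (ha : a ∈ Set.Icc 1 m) : {x | b < l x} ⊆ {x | a < l x} ↔ a ≤ b := by
  refine ⟨fun hab => not_lt.1 fun hlt => ?_, fun hab x hx => lt_of_le_of_lt hab hx⟩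
  obtain ⟨x, hx⟩ := h.exists_left ha
  have := hab (show b < l x by omega)
  simp only [Set.mem_ofPred_eq] at this
  omega

lemma injOn_downSet (h : IsCanonicalRep P m l u) :
    Set.InjOn (fun a => {x | u x < a}) (Set.Icc 1 m) := fun _ ha _ hb hab =>
  le_antisymm ((h.downSet_subset_iff hb).1 hab.le) ((h.downSet_subset_iff ha).1 hab.ge)

lemma injOn_upSet (h : IsCanonicalRep P m l u) :
    Set.InjOn (fun a => {x | a < l x}) (Set.Icc 1 m) := fun _ ha _ hb hab =>
  le_antisymm ((h.upSet_subset_iff ha).1 hab.ge) ((h.upSet_subset_iff hb).1 hab.le)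

lemma ncard_Icc_one (a : ℕ) : (Set.Icc 1 a).ncard = a := by
  rw [← Finset.coe_Icc, Set.ncard_coe_finset, Nat.card_Icc, Nat.add_sub_cancel]

lemma magnitude_eq (h : IsCanonicalRep P m l u) : magnitude P = m := by
  rw [magnitude, h.downSets_eq, h.injOn_downSet.ncard_image, ncard_Icc_one]

/-- The strict down-sets inside `D(x)` are the distinct sets `{u < a}` with `1 ≤ a ≤ l x`. So the
left endpoints are forced by the order alone. -/
lemma level_eq (h : IsCanonicalRep P m l u) (x : P) : level x = l x := by
  have hx := h.left_mem x
  have hI : Set.Iio x = {y | u y < l x} := Set.ext fun y => h.lt_iff y x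
  have hsub : Set.Icc 1 (l x) ⊆ Set.Icc 1 m := Set.Icc_subset_Icc_right hx.2
  have : {D ∈ downSets P | D ⊆ Set.Iio x} = (fun a => {y | u y < a}) '' Set.Icc 1 (l x) := by
    rw [h.downSets_eq, hI]
    ext D
    constructor
    · rintro ⟨⟨a, ha, rfl⟩, hD⟩
      exact ⟨a, ⟨ha.1, (h.downSet_subset_iff hx).1 hD⟩, rfl⟩
    · rintro ⟨a, ha, rfl⟩
      exact ⟨⟨a, hsub ha, rfl⟩, (h.downSet_subset_iff hx).2 ha.2⟩
  rw [level, this, (h.injOn_downSet.mono hsub).ncard_image, ncard_Icc_one]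

lemma upLevel_eq (h : IsCanonicalRep P m l u) (x : P) : upLevel x = u x := by
  have hx := h.right_mem x
  have hI : Set.Ioi x = {y | u x < l y} := Set.ext fun y => h.lt_iff x y
  have hsub : Set.Icc 1 (u x) ⊆ Set.Icc 1 m := Set.Icc_subset_Icc_right hx.2
  have : {U ∈ upSets P | Set.Ioi x ⊆ U} = (fun a => {y | a < l y}) '' Set.Icc 1 (u x) := by
    rw [h.upSets_eq, hI]
    ext D
    constructor
    · rintro ⟨⟨a, ha, rfl⟩, hD⟩
      exact ⟨a, ⟨ha.1, (h.upSet_subset_iff ha).1 hD⟩, rfl⟩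
    · rintro ⟨a, ha, rfl⟩
      exact ⟨⟨a, hsub ha, rfl⟩, (h.upSet_subset_iff (hsub ha)).2 ha.2⟩
  rw [upLevel, this, (h.injOn_upSet.mono hsub).ncard_image, ncard_Icc_one]

/-- The Fishburn matrix can be read off from any canonical representation. -/
lemma sigma_fishburnMatrix_eq (h : IsCanonicalRep P m l u) :
    (⟨magnitude P, fishburnMatrix P⟩ : Σ m : ℕ, Matrix (Fin m) (Fin m) ℕ) =
      ⟨m, Matrix.of fun i j => {x : P | l x = (i : ℕ) + 1 ∧ u x = (j : ℕ) + 1}.ncard⟩ := by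
  obtain rfl := h.magnitude_eq
  simp only [fishburnMatrix, h.level_eq, h.upLevel_eq]

lemma comp_orderIso (h : IsCanonicalRep P m l u) (e : Q ≃o P) :
    IsCanonicalRep Q m (l ∘ e) (u ∘ e) where
  lt_iff x y := by rw [← e.lt_iff_lt]; exact h.lt_iff _ _
  range_left := by rw [e.surjective.range_comp, h.range_left]
  range_right := by rw [e.surjective.range_comp, h.range_right]

/-- Reflecting the line by `a ↦ m + 1 - a` exchanges left and right endpoints. -/
lemma orderDual (h : IsCanonicalRep P m l u) :
    IsCanonicalRep Pᵒᵈ m (fun x => m + 1 - u (OrderDual.ofDual x))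
      (fun x => m + 1 - l (OrderDual.ofDual x)) where
  lt_iff x y := by
    rw [← OrderDual.ofDual_lt_ofDual, h.lt_iff]
    have h1 := h.left_mem (OrderDual.ofDual x)
    have h2 := h.right_mem (OrderDual.ofDual y)
    simp only [Set.mem_Icc] at h1 h2
    omega
  range_left := by
    ext a
    constructor
    · rintro ⟨x, rfl⟩
      have := h.right_mem (OrderDual.ofDual x)
      simp only [Set.mem_Icc] at this ⊢
      omega
    · intro ha
      simp only [Set.mem_Icc] at ha
      obtain ⟨x, hx⟩ := h.exists_right (a := m + 1 - a) (by simp only [Set.mem_Icc]; omega)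
      exact ⟨OrderDual.toDual x, by simp only [OrderDual.ofDual_toDual]; omega⟩
  range_right := by
    ext a
    constructor
    · rintro ⟨x, rfl⟩
      have := h.left_mem (OrderDual.ofDual x)
      simp only [Set.mem_Icc] at this ⊢
      omega
    · intro ha
      simp only [Set.mem_Icc] at ha
      obtain ⟨x, hx⟩ := h.exists_left (a := m + 1 - a) (by simp only [Set.mem_Icc]; omega)
      exact ⟨OrderDual.toDual x, by simp only [OrderDual.ofDual_toDual]; omega⟩

/-- Posets whose canonical representations have the same multiplicities are isomorphic. -/
lemma nonempty_orderIso [Finite P] [Finite Q] (h : IsCanonicalRep P m l u)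
    (h' : IsCanonicalRep Q m l' u')
    (hc : ∀ a b, a ∈ Set.Icc 1 m → b ∈ Set.Icc 1 m →
      {x | l x = a ∧ u x = b}.ncard = {x | l' x = a ∧ u' x = b}.ncard) :
    Nonempty (P ≃o Q) := by
  have key : ∀ p : ℕ × ℕ,
      Nonempty ({x : P // (l x, u x) = p} ≃ {x : Q // (l' x, u' x) = p}) := by
    rintro ⟨a, b⟩
    by_cases hab : a ∈ Set.Icc 1 m ∧ b ∈ Set.Icc 1 m
    · have := hc a b hab.1 hab.2
      simp only [← Prod.mk.injEq] at this
      exact Finite.card_eq.1 this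
    · have h1 : IsEmpty {x : P // (l x, u x) = (a, b)} := ⟨fun x => hab (by
        obtain ⟨x, hx⟩ := x
        obtain ⟨rfl, rfl⟩ := Prod.mk.inj hx
        exact ⟨h.left_mem x, h.right_mem x⟩)⟩
      have h2 : IsEmpty {x : Q // (l' x, u' x) = (a, b)} := ⟨fun x => hab (by
        obtain ⟨x, hx⟩ := x
        obtain ⟨rfl, rfl⟩ := Prod.mk.inj hx
        exact ⟨h'.left_mem x, h'.right_mem x⟩)⟩
      exact ⟨Equiv.equivOfIsEmpty _ _⟩
  have E := fun p => (key p).some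
  -- Bijections between the fibres over equal endpoint pairs are glued; the strict order depends on
  -- the endpoints only.
  let e : P ≃ Q := (Equiv.sigmaFiberEquiv fun x => (l x, u x)).symm.trans
    ((Equiv.sigmaCongrRight E).trans (Equiv.sigmaFiberEquiv fun x => (l' x, u' x)))
  have he : ∀ x, (l' (e x), u' (e x)) = (l x, u x) := fun x =>
    (E (l x, u x) ⟨x, rfl⟩).2
  refine ⟨⟨e, fun {x y} => ?_⟩⟩
  rw [le_iff_eq_or_lt, le_iff_eq_or_lt, e.injective.eq_iff, h.lt_iff, h'.lt_iff,
    (Prod.mk.inj (he x)).2, (Prod.mk.inj (he y)).1]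

end IsCanonicalRep

/-! ### Existence of the canonical representation -/

section IntervalOrders

variable {P : Type*} [PartialOrder P]

/-- If `a < x` witnesses one failure of inclusion and `b < y` the other, these two chains form an
induced `2 + 2`. -/
lemma IsIntervalOrder.Iio_subset_total (hP : IsIntervalOrder P) (x y : P) :
    Set.Iio x ⊆ Set.Iio y ∨ Set.Iio y ⊆ Set.Iio x := by
  by_contra hcon
  push Not at hcon
  obtain ⟨h1, h2⟩ := hcon
  obtain ⟨a, hax, hay⟩ := Set.not_subset.1 h1
  obtain ⟨b, hby, hbx⟩ := Set.not_subset.1 h2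
  simp only [Set.mem_Iio] at hax hay hby hbx
  have n1 : ¬ a ≤ b := fun h => hay (h.trans_lt hby)
  have n2 : ¬ b ≤ a := fun h => hbx (h.trans_lt hax)
  have n3 : ¬ a ≤ y := fun h => h.lt_or_eq.elim hay fun e => hbx (hby.trans (e ▸ hax))
  have n4 : ¬ b ≤ x := fun h => h.lt_or_eq.elim hbx fun e => hay (hax.trans (e ▸ hby))
  have n5 : ¬ x ≤ b := fun h => hay ((hax.trans_le h).trans hby)
  have n6 : ¬ y ≤ a := fun h => hbx ((hby.trans_le h).trans hax)
  have n7 : ¬ x ≤ y := fun h => hay (hax.trans_le h)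
  have n8 : ¬ y ≤ x := fun h => hbx (hby.trans_le h)
  let f : Fin 2 ⊕ Fin 2 → P := Sum.elim ![a, x] ![b, y]
  have hf : ∀ p q, f p ≤ f q ↔ p ≤ q := by
    rintro (p | p) (q | q) <;> fin_cases p <;> fin_cases q <;>
      simp [f, n1, n2, n3, n4, n5, n6, n7, n8, hax.le, hby.le, hax.not_ge, hby.not_ge]
  exact hP.false (OrderEmbedding.ofMapLEIff f hf)

variable [Finite P]

lemma IsIntervalOrder.level_le_level_iff (hP : IsIntervalOrder P) {x y : P} :
    level x ≤ level y ↔ Set.Iio x ⊆ Set.Iio y := by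
  refine ⟨fun h => ?_, fun h => Set.ncard_le_ncard (fun D hD => ⟨hD.1, hD.2.trans h⟩)
    (Set.toFinite _)⟩
  by_contra hxy
  have hyx := (hP.Iio_subset_total x y).resolve_left hxy
  refine absurd h (not_le.2 (Set.ncard_lt_ncard ⟨fun D hD => ⟨hD.1, hD.2.trans hyx⟩,
    fun hsub => hxy (hsub ⟨⟨x, rfl⟩, subset_rfl⟩).2⟩ (Set.toFinite _)))

lemma IsIntervalOrder.range_level (hP : IsIntervalOrder P) :
    Set.range (level : P → ℕ) = Set.Icc 1 (magnitude P) := by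
  let φ : Set P → ℕ := fun D => {E ∈ downSets P | E ⊆ D}.ncard
  have hr : Set.range (level : P → ℕ) = φ '' downSets P := by
    rw [downSets, ← Set.range_comp]; rfl
  have hinj : Set.InjOn φ (downSets P) := by
    rintro _ ⟨x, rfl⟩ _ ⟨y, rfl⟩ hxy
    have hxy' : level x = level y := hxy
    exact (hP.level_le_level_iff.1 hxy'.le).antisymm (hP.level_le_level_iff.1 hxy'.ge)
  refine Set.eq_of_subset_of_ncard_le ?_ ?_ (Set.finite_Icc _ _)
  · rintro _ ⟨x, rfl⟩
    refine ⟨?_, Set.ncard_le_ncard (fun D hD => hD.1) (Set.toFinite _)⟩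
    exact (Set.ncard_pos (Set.toFinite _)).2 ⟨Set.Iio x, ⟨x, rfl⟩, subset_rfl⟩
  · rw [hr, hinj.ncard_image, IsCanonicalRep.ncard_Icc_one, magnitude]

/-- Every finite interval order has a canonical representation. -/
lemma IsIntervalOrder.isCanonicalRep (hP : IsIntervalOrder P) :
    IsCanonicalRep P (magnitude P) level upLevel := by
  -- The right endpoint of `x` is the largest level among the elements not above `x`; being above
  -- `x` is then the same as having larger level.
  have hmax : ∀ x : P, ∃ z, ¬ x < z ∧ ∀ y, ¬ x < y → level y ≤ level z := fun x => by
    obtain ⟨z, hz, h⟩ := Set.exists_max_image {z | ¬ x < z} level (Set.toFinite _)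
      ⟨x, lt_irrefl x⟩
    exact ⟨z, hz, h⟩
  choose z hz hzmax using hmax
  have hmem : ∀ x : P, level x ∈ Set.Icc 1 (magnitude P) := fun x =>
    hP.range_level ▸ Set.mem_range_self x
  have hlt : ∀ x y, x < y ↔ level (z x) < level y := by
    refine fun x y => ⟨fun h => not_le.1 fun hle => ?_, fun h => by_contra fun hn => ?_⟩
    · exact hz x (hP.level_le_level_iff.1 hle h)
    · exact (hzmax x y hn).not_gt h
  have key : IsCanonicalRep P (magnitude P) level (fun x => level (z x)) := by
    refine ⟨hlt, hP.range_level, Set.Subset.antisymm ?_ ?_⟩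
    · rintro _ ⟨x, rfl⟩
      exact hmem _
    · intro a ha
      obtain ⟨y, hy⟩ : a ∈ Set.range (level : P → ℕ) := hP.range_level ▸ ha
      -- At the top level, `y` itself has right endpoint `a`. Below it, some `x` lies under an
      -- element of level `a + 1` but not under one of level `a`, so `x` ends exactly at `a`.
      rcases ha.2.eq_or_lt with h | h
      · exact ⟨y, le_antisymm (h ▸ (hmem _).2) (hy ▸ hzmax y y (lt_irrefl y))⟩
      · obtain ⟨w, hw⟩ : a + 1 ∈ Set.range (level : P → ℕ) :=
          hP.range_level ▸ ⟨by omega, h⟩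
        have hwy : ¬ Set.Iio w ⊆ Set.Iio y := fun hs => by
          have := hP.level_le_level_iff.2 hs
          omega
        obtain ⟨x, hxw, hxy⟩ := Set.not_subset.1 hwy
        have h1 := (hlt x w).1 hxw
        have h2 := hzmax x y hxy
        exact ⟨x, by simp only; omega⟩
  have hu : (fun x => level (z x)) = (upLevel : P → ℕ) :=
    funext fun x => (key.upLevel_eq x).symm
  rwa [hu] at key

end IntervalOrders

/-! ### Fishburn's bijection and duality -/

section MatrixOrder

variable {m : ℕ}

/-- The elements of the poset of an upper-triangular matrix: each cell `(i, j)` with `i ≤ j`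
contributes as many elements as its entry says. -/
def MatrixOrder (M : Matrix (Fin m) (Fin m) ℕ) : Type :=
  Σ p : {p : Fin m × Fin m // p.1 ≤ p.2}, Fin (M p.1.1 p.1.2)

namespace MatrixOrder

variable {M : Matrix (Fin m) (Fin m) ℕ}

/-- The row of an element. -/
def row (x : MatrixOrder M) : Fin m := x.1.1.1

/-- The column of an element. -/
def col (x : MatrixOrder M) : Fin m := x.1.1.2

lemma row_le_col (x : MatrixOrder M) : x.row ≤ x.col := x.1.2

noncomputable instance : Fintype (MatrixOrder M) :=
  inferInstanceAs (Fintype (Σ p : {p : Fin m × Fin m // p.1 ≤ p.2}, Fin (M p.1.1 p.1.2)))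

instance : PartialOrder (MatrixOrder M) where
  le x y := x = y ∨ x.col < y.row
  le_refl x := Or.inl rfl
  le_trans x y z := by
    rintro (rfl | h1) (rfl | h2)
    · exact Or.inl rfl
    · exact Or.inr h2
    · exact Or.inr h1
    · exact Or.inr (h1.trans (y.row_le_col.trans_lt h2))
  le_antisymm x y := by
    rintro (rfl | h1) (h | h2)
    · rfl
    · rfl
    · exact h.symm
    · exact absurd (h1.trans (y.row_le_col.trans_lt h2)) x.row_le_col.not_gt

lemma lt_iff (x y : MatrixOrder M) : x < y ↔ x.col < y.row := by
  rw [lt_iff_le_and_ne]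
  constructor
  · rintro ⟨h | h, hne⟩
    · exact absurd h hne
    · exact h
  · intro h
    exact ⟨Or.inr h, by rintro rfl; exact x.row_le_col.not_gt h⟩

lemma ncard_cell (hM : IsUpperTriangular M) (i j : Fin m) :
    {x : MatrixOrder M | x.row = i ∧ x.col = j}.ncard = M i j := by
  by_cases hij : i ≤ j
  · let f : Fin (M i j) → MatrixOrder M := fun t => ⟨⟨(i, j), hij⟩, t⟩
    have hf : Function.Injective f := fun s t hst => by
      exact eq_of_heq (Sigma.mk.inj hst).2
    have : {x : MatrixOrder M | x.row = i ∧ x.col = j} = Set.range f := by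
      ext x
      constructor
      · rintro ⟨rfl, rfl⟩
        exact ⟨x.2, rfl⟩
      · rintro ⟨t, rfl⟩
        exact ⟨rfl, rfl⟩
    rw [this, Set.ncard_def, ← Set.image_univ, hf.encard_image]
    simp
  · rw [hM i j (not_le.1 hij), Set.ncard_eq_zero (Set.toFinite _)]
    refine Set.eq_empty_of_forall_notMem fun x hx => hij ?_
    rw [← hx.1, ← hx.2]
    exact x.row_le_col

lemma exists_mem_cell (hM : IsUpperTriangular M) {i j : Fin m} (h : M i j ≠ 0) :
    ∃ x : MatrixOrder M, x.row = i ∧ x.col = j :=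
  Set.nonempty_of_ncard_ne_zero (s := {x : MatrixOrder M | x.row = i ∧ x.col = j})
    (by rwa [ncard_cell hM])

lemma isCanonicalRep (hM : IsFishburn M) :
    IsCanonicalRep (MatrixOrder M) m (fun x => (x.row : ℕ) + 1) (fun x => (x.col : ℕ) + 1) where
  lt_iff x y := by rw [lt_iff, Fin.lt_def]; omega
  range_left := by
    ext a
    constructor
    · rintro ⟨x, rfl⟩
      exact ⟨by simp, x.row.2⟩
    · rintro ⟨h1, h2⟩
      obtain ⟨j, hj⟩ := hM.2.1 ⟨a - 1, by omega⟩
      obtain ⟨x, hx, -⟩ := exists_mem_cell hM.1 hj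
      exact ⟨x, by simp only [hx]; omega⟩
  range_right := by
    ext a
    constructor
    · rintro ⟨x, rfl⟩
      exact ⟨by simp, x.col.2⟩
    · rintro ⟨h1, h2⟩
      obtain ⟨i, hi⟩ := hM.2.2 ⟨a - 1, by omega⟩
      obtain ⟨x, -, hx⟩ := exists_mem_cell hM.1 hi
      exact ⟨x, by simp only [hx]; omega⟩

/-- The Fishburn matrix of the poset of a Fishburn matrix is the given matrix. -/
lemma sigma_fishburnMatrix_eq (hM : IsFishburn M) :
    (⟨magnitude (MatrixOrder M), fishburnMatrix (MatrixOrder M)⟩ :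
      Σ m : ℕ, Matrix (Fin m) (Fin m) ℕ) = ⟨m, M⟩ := by
  rw [(isCanonicalRep hM).sigma_fishburnMatrix_eq]
  congr 1
  ext i j
  simp only [Matrix.of_apply, Nat.add_right_cancel_iff, Fin.val_inj]
  exact ncard_cell hM.1 i j

end MatrixOrder

variable {P : Type*} [PartialOrder P] [Finite P]

lemma IsIntervalOrder.isFishburn (hP : IsIntervalOrder P) : IsFishburn (fishburnMatrix P) := by
  have h := hP.isCanonicalRep
  refine ⟨fun i j hij => ?_, fun i => ?_, fun j => ?_⟩
  · simp only [fishburnMatrix, Matrix.of_apply, Set.ncard_eq_zero (Set.toFinite _)]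
    refine Set.eq_empty_of_forall_notMem fun x hx => ?_
    have h1 := h.left_le_right x
    rw [hx.1, hx.2] at h1
    exact absurd hij (not_lt.2 (Fin.le_def.2 (by omega)))
  · obtain ⟨x, hx⟩ := h.exists_left (a := i + 1) ⟨by omega, i.2⟩
    have hu := h.right_mem x
    simp only [Set.mem_Icc] at hu
    refine ⟨⟨upLevel x - 1, by omega⟩, Set.ncard_ne_zero_of_mem (a := x) ⟨hx, ?_⟩
      (Set.toFinite _)⟩
    simp only
    omega
  · obtain ⟨x, hx⟩ := h.exists_right (a := j + 1) ⟨by omega, j.2⟩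
    have hu := h.left_mem x
    simp only [Set.mem_Icc] at hu
    refine ⟨⟨level x - 1, by omega⟩, Set.ncard_ne_zero_of_mem (a := x) ⟨?_, hx⟩
      (Set.toFinite _)⟩
    simp only
    omega

/-- The Fishburn matrix of the dual order is the dual matrix. -/
lemma IsIntervalOrder.sigma_fishburnMatrix_orderDual (hP : IsIntervalOrder P) :
    (⟨magnitude Pᵒᵈ, fishburnMatrix Pᵒᵈ⟩ : Σ m : ℕ, Matrix (Fin m) (Fin m) ℕ) =
      ⟨magnitude P, dual (fishburnMatrix P)⟩ := by
  have h := hP.isCanonicalRep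
  rw [h.orderDual.sigma_fishburnMatrix_eq]
  congr 1
  ext i j
  simp only [Matrix.of_apply, dual, fishburnMatrix, Fin.val_rev]
  have : {x : Pᵒᵈ | magnitude P + 1 - upLevel (OrderDual.ofDual x) = (i : ℕ) + 1 ∧
      magnitude P + 1 - level (OrderDual.ofDual x) = (j : ℕ) + 1} =
      OrderDual.toDual '' {x : P | level x = magnitude P - (j + 1) + 1 ∧
        upLevel x = magnitude P - (i + 1) + 1} := by
    ext x
    have h1 := h.left_mem (OrderDual.ofDual x)
    have h2 := h.right_mem (OrderDual.ofDual x)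
    simp only [Set.mem_Icc] at h1 h2
    have hi := i.2
    have hj := j.2
    constructor
    · rintro ⟨ha, hb⟩
      exact ⟨OrderDual.ofDual x, ⟨by omega, by omega⟩, rfl⟩
    · rintro ⟨y, ⟨ha, hb⟩, rfl⟩
      simp only [OrderDual.ofDual_toDual] at h1 h2
      simp only [Set.mem_ofPred_eq, OrderDual.ofDual_toDual]
      omega
  rw [this, Set.ncard_image_of_injective _ OrderDual.toDual.injective]

lemma IsIntervalOrder.nonempty_orderIso_of_sigma_eq {Q : Type*} [PartialOrder Q] [Finite Q]
    (hP : IsIntervalOrder P) (hQ : IsIntervalOrder Q)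
    (h : (⟨magnitude P, fishburnMatrix P⟩ : Σ m : ℕ, Matrix (Fin m) (Fin m) ℕ) =
      ⟨magnitude Q, fishburnMatrix Q⟩) : Nonempty (P ≃o Q) := by
  have h1 := hP.isCanonicalRep
  have h2 := hQ.isCanonicalRep
  unfold fishburnMatrix at h
  generalize magnitude P = m at *
  generalize magnitude Q = m' at *
  obtain ⟨rfl, hM⟩ := Sigma.mk.inj h
  have hM := eq_of_heq hM
  refine h1.nonempty_orderIso h2 fun a b ha hb => ?_
  simp only [Set.mem_Icc] at ha hb
  have := congrFun (congrFun hM ⟨a - 1, by omega⟩) ⟨b - 1, by omega⟩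
  simp only [Matrix.of_apply] at this
  rwa [Nat.sub_add_cancel ha.1, Nat.sub_add_cancel hb.1] at this

/-- The matrix is a complete invariant, and passing to the dual order reflects it. -/
lemma IsIntervalOrder.isSelfDual_iff (hP : IsIntervalOrder P) :
    IsSelfDual P ↔ dual (fishburnMatrix P) = fishburnMatrix P := by
  have hd := hP.sigma_fishburnMatrix_orderDual
  constructor
  · rintro ⟨e⟩
    have h1 := (hP.isCanonicalRep.orderDual.comp_orderIso e).sigma_fishburnMatrix_eq
    have h2 := hP.isCanonicalRep.orderDual.sigma_fishburnMatrix_eq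
    have h3 : ∀ a b : ℕ, {x : P | magnitude P + 1 - upLevel (OrderDual.ofDual (e x)) = a ∧
        magnitude P + 1 - level (OrderDual.ofDual (e x)) = b}.ncard =
        {x : Pᵒᵈ | magnitude P + 1 - upLevel (OrderDual.ofDual x) = a ∧
        magnitude P + 1 - level (OrderDual.ofDual x) = b}.ncard := fun a b =>
      Set.ncard_preimage_of_injective_subset_range (f := e)
        (s := {x : Pᵒᵈ | magnitude P + 1 - upLevel (OrderDual.ofDual x) = a ∧
        magnitude P + 1 - level (OrderDual.ofDual x) = b}) e.injective
        (by rw [e.surjective.range_eq]; exact Set.subset_univ _)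
    simp only [Function.comp_apply, h3] at h1
    rw [← h2, hd] at h1
    exact (eq_of_heq (Sigma.mk.inj h1).2).symm
  · intro h
    refine hP.nonempty_orderIso_of_sigma_eq hP.isCanonicalRep.orderDual.isIntervalOrder ?_
    rw [hd, h]

/-- The isomorphism class of the poset of a matrix. -/
noncomputable def matrixOrderClass (M : Σ m : ℕ, Matrix (Fin m) (Fin m) ℕ) :
    Quotient isoSetoid :=
  Quotient.mk isoSetoid (FinPartOrd.of (MatrixOrder M.2))

/-- Row and column are level and up-level, which an isomorphism preserves, so the cell counts agree.
-/
lemma injOn_matrixOrderClass : Set.InjOn matrixOrderClass {M | IsFishburn M.2} := by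
  rintro ⟨m, M⟩ hM ⟨m', M'⟩ hM' h
  obtain ⟨e⟩ : Nonempty (MatrixOrder M ≃o MatrixOrder M') := Quotient.exact h
  have h1 := MatrixOrder.isCanonicalRep hM
  have h2 := (MatrixOrder.isCanonicalRep hM').comp_orderIso e
  have h3 := h2.magnitude_eq
  rw [h1.magnitude_eq] at h3
  obtain rfl : m = m' := h3
  congr 1
  ext i j
  refine (MatrixOrder.ncard_cell hM.1 i j).symm.trans
    (Eq.trans ?_ (MatrixOrder.ncard_cell hM'.1 i j))
  have h4 : ∀ x, ((e x).row : ℕ) + 1 = (x.row : ℕ) + 1 := fun x =>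
    (h2.level_eq x).symm.trans (h1.level_eq x)
  have h5 : ∀ x, ((e x).col : ℕ) + 1 = (x.col : ℕ) + 1 := fun x =>
    (h2.upLevel_eq x).symm.trans (h1.upLevel_eq x)
  have h6 : {x : MatrixOrder M | x.row = i ∧ x.col = j} =
      e ⁻¹' {x : MatrixOrder M' | x.row = i ∧ x.col = j} := by
    ext x
    have := h4 x
    have := h5 x
    simp only [Set.mem_ofPred_eq, Set.mem_preimage, Fin.ext_iff]
    omega
  rw [h6, Set.ncard_preimage_of_injective_subset_range e.injective
    (by rw [e.surjective.range_eq]; exact Set.subset_univ _)]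

/-- Fishburn's bijection restricts to self-dual objects of a given reduced size. -/
lemma selfDualIntervalOrders_eq_image (n : ℕ) :
    selfDualIntervalOrders n = matrixOrderClass '' selfDualFishburnMatrices n := by
  have red : ∀ {M N : Σ m : ℕ, Matrix (Fin m) (Fin m) ℕ}, M = N →
      reducedSize M.2 = reducedSize N.2 := by rintro _ _ rfl; rfl
  have dua : ∀ {M N : Σ m : ℕ, Matrix (Fin m) (Fin m) ℕ}, M = N →
      (dual M.2 = M.2 ↔ dual N.2 = N.2) := by rintro _ _ rfl; rfl
  ext q
  constructor
  · rintro ⟨P, ⟨hP, hsd, hn⟩, rfl⟩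
    refine ⟨⟨magnitude P, fishburnMatrix P⟩,
      ⟨hP.isFishburn, hP.isSelfDual_iff.1 hsd, hn⟩, Quotient.sound ?_⟩
    exact (MatrixOrder.isCanonicalRep hP.isFishburn).isIntervalOrder.nonempty_orderIso_of_sigma_eq
      hP (MatrixOrder.sigma_fishburnMatrix_eq hP.isFishburn)
  · rintro ⟨M, ⟨hM, hsd, hn⟩, rfl⟩
    have h := MatrixOrder.sigma_fishburnMatrix_eq hM
    have hI := (MatrixOrder.isCanonicalRep hM).isIntervalOrder
    refine ⟨FinPartOrd.of (MatrixOrder M.2), ⟨hI, ?_, ?_⟩, rfl⟩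
    · exact hI.isSelfDual_iff.2 ((dua h).2 hsd)
    · exact (red h).trans hn

end MatrixOrder

end SelfDualIntervalOrder

namespace SelfDualIntervalOrder

open Polynomial

/-! ### Generating functions of vectors with prescribed supports -/

section GeneratingFunctions

/-- The truncated geometric series `1 + X + ⋯ + X ^ n`. -/
noncomputable def geom (n : ℕ) : ℤ[X] := ∑ i : Fin (n + 1), X ^ (i : ℕ)

/-- The constant term of `geom n` is `1`. Each vector required to be nonzero thus costs a factor
`X`, which bounds the dimensions that matter. -/
lemma X_dvd_geom_pow_sub_one (n r : ℕ) : X ∣ geom n ^ r - 1 := by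
  rw [X_dvd_iff, coeff_zero_eq_eval_zero, eval_sub, eval_pow, geom, eval_finsetSum,
    Fin.sum_univ_succ]
  simp

/-- The generating function of the number of vectors supported on a given set. -/
lemma sum_vectors {ι : Type*} [Fintype ι] [DecidableEq ι] (n : ℕ) (Q : Finset ι) :
    ∑ v : ι → Fin (n + 1),
      (if ∀ i, i ∉ Q → v i = 0 then (X : ℤ[X]) ^ ∑ i, (v i : ℕ) else 0) = geom n ^ Q.card := by
  have h1 : ∀ v : ι → Fin (n + 1),
      (if ∀ i, i ∉ Q → v i = 0 then (X : ℤ[X]) ^ ∑ i, (v i : ℕ) else 0) =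
        ∏ i, if i ∉ Q → v i = 0 then (X : ℤ[X]) ^ (v i : ℕ) else 0 := fun v => by
    rw [Finset.prod_ite_zero, Finset.prod_pow_eq_pow_sum]
    simp only [Finset.mem_univ, true_imp_iff]
  have h2 := Finset.prod_univ_sum (fun _ : ι => (Finset.univ : Finset (Fin (n + 1))))
    (fun i a => if i ∉ Q → a = 0 then (X : ℤ[X]) ^ (a : ℕ) else 0)
  rw [Fintype.piFinset_univ] at h2
  rw [Finset.sum_congr rfl fun v _ => h1 v, ← h2]
  have h3 : ∀ i, (∑ a : Fin (n + 1), if i ∉ Q → a = 0 then (X : ℤ[X]) ^ (a : ℕ) else 0) =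
      if i ∈ Q then geom n else 1 := fun i => by
    by_cases hi : i ∈ Q
    · simp [hi, geom]
    · simp [hi]
  rw [Finset.prod_congr rfl fun i _ => h3 i, Finset.prod_ite_mem, Finset.univ_inter,
    Finset.prod_const]

lemma sum_nonzero_vectors {ι : Type*} [Fintype ι] [DecidableEq ι] (n : ℕ) (Q : Finset ι)
    (p : Prop) [Decidable p] :
    ∑ v : ι → Fin (n + 1),
      (if (∀ i, i ∉ Q → v i = 0) ∧ (p → v ≠ 0) then (X : ℤ[X]) ^ ∑ i, (v i : ℕ) else 0) =
        geom n ^ Q.card - if p then 1 else 0 := by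
  have h1 : ∀ v : ι → Fin (n + 1),
      (if (∀ i, i ∉ Q → v i = 0) ∧ (p → v ≠ 0) then (X : ℤ[X]) ^ ∑ i, (v i : ℕ) else 0) =
      (if ∀ i, i ∉ Q → v i = 0 then (X : ℤ[X]) ^ ∑ i, (v i : ℕ) else 0) -
        if v = 0 then (if p then 1 else 0) else 0 := fun v => by
    by_cases hv : v = 0
    · subst hv
      by_cases hp : p <;> simp [hp]
    · simp [hv]
  rw [Finset.sum_congr rfl fun v _ => h1 v, Finset.sum_sub_distrib, sum_vectors]
  simp

/-- The generating function of families of vectors with prescribed supports, where the vectors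
with index in `K` must not vanish. -/
lemma sum_families {κ ι : Type*} [Fintype κ] [DecidableEq κ] [Fintype ι] [DecidableEq ι] (n : ℕ)
    (Q : κ → Finset ι) (K : κ → Prop) [DecidablePred K] (p : (κ → ι → Fin (n + 1)) → Prop)
    [DecidablePred p] (hp : ∀ f, p f ↔ ∀ j, (∀ i, i ∉ Q j → f j i = 0) ∧ (K j → f j ≠ 0)) :
    ∑ f : κ → ι → Fin (n + 1), (if p f then (X : ℤ[X]) ^ ∑ j, ∑ i, (f j i : ℕ) else 0) =
      ∏ j, (geom n ^ (Q j).card - if K j then 1 else 0) := by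
  have h1 : ∀ f : κ → ι → Fin (n + 1),
      (if p f then (X : ℤ[X]) ^ ∑ j, ∑ i, (f j i : ℕ) else 0) =
      ∏ j, if (∀ i, i ∉ Q j → f j i = 0) ∧ (K j → f j ≠ 0) then
        (X : ℤ[X]) ^ ∑ i, (f j i : ℕ) else 0 := fun f => by
    rw [Finset.prod_ite_zero, Finset.prod_pow_eq_pow_sum]
    simp only [Finset.mem_univ, true_imp_iff, hp]
  have h2 := Finset.prod_univ_sum (fun _ : κ => (Finset.univ : Finset (ι → Fin (n + 1))))
    (fun j v => if (∀ i, i ∉ Q j → v i = 0) ∧ (K j → v ≠ 0) then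
        (X : ℤ[X]) ^ ∑ i, (v i : ℕ) else 0)
  rw [Fintype.piFinset_univ] at h2
  rw [Finset.sum_congr rfl fun f _ => h1 f, ← h2]
  exact Finset.prod_congr rfl fun j _ => sum_nonzero_vectors n (Q j) (K j)

lemma coeff_sum_ite_X_pow {α : Type*} [Fintype α] (p : α → Prop) [DecidablePred p] (w : α → ℕ)
    (n : ℕ) : (∑ a, if p a then (X : ℤ[X]) ^ w a else 0).coeff n =
      ((Finset.univ.filter fun a => p a ∧ w a = n).card : ℤ) := by
  rw [finsetSum_coeff, Finset.card_filter, Nat.cast_sum]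
  refine Finset.sum_congr rfl fun a _ => ?_
  by_cases h : p a
  · simp [h, coeff_X_pow, eq_comm]
  · simp [h]

/-- Inclusion-exclusion for an indicator function. -/
lemma ite_forall_not_eq_sum {R : Type*} [CommRing R] (s : Finset ℕ) (z : ℕ → Prop)
    [DecidablePred z] (p : Prop) [Decidable p] (a : R) :
    (if p ∧ ∀ c ∈ s, ¬ z c then a else 0) =
      ∑ S ∈ s.powerset, (-1) ^ S.card * if p ∧ ∀ c ∈ S, z c then a else 0 := by
  have h := Finset.prod_one_add (R := R) (f := fun c => -(if z c then 1 else 0)) s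
  have h1 : ∏ c ∈ s, (1 + -(if z c then (1 : R) else 0)) = if ∀ c ∈ s, ¬ z c then 1 else 0 := by
    rw [← Finset.prod_const_one (s := s), ← Finset.prod_ite_zero]
    refine Finset.prod_congr rfl fun c _ => ?_
    by_cases hc : z c <;> simp [hc]
  have h2 : ∀ S : Finset ℕ, ∏ c ∈ S, -(if z c then (1 : R) else 0) =
      (-1) ^ S.card * if ∀ c ∈ S, z c then 1 else 0 := fun S => by
    rw [Finset.prod_neg, Finset.prod_ite_zero, Finset.prod_const_one]
  rw [h1, Finset.sum_congr rfl fun S _ => h2 S] at h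
  by_cases hp : p
  · have h' := congrArg (· * a) h
    simpa [hp, Finset.sum_mul, mul_assoc, ite_mul] using h'
  · simp [hp]

end GeneratingFunctions

/-! ### The recursion behind the inclusion-exclusion sum -/

section SignedSums

/-- One step of the recursion for signed sums over subsets. -/
noncomputable def subsetStep (g : ℤ[X]) (h : ℕ → ℤ[X]) (r : ℕ) : ℤ[X] :=
  h (r + 1) * g ^ (r + 1) * (g ^ (r + 1) - 1) - h r * (g ^ r - 1)

lemma card_range_sdiff {k : ℕ} {S : Finset ℕ} (hS : S ⊆ Finset.range k) :
    (Finset.range k \ S).card = k - S.card := by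
  rw [Finset.card_sdiff_of_subset hS, Finset.card_range]

/-- The signed sum of weights of subsets of `range k` obeys a linear recursion. -/
lemma sum_powerset_range_eq_iterate (g : ℤ[X]) (k : ℕ) (h : ℕ → ℤ[X]) :
    ∑ S ∈ (Finset.range k).powerset, (-1) ^ S.card *
      ((∏ c ∈ Finset.range k, (g ^ (Finset.range (c + 1) \ S).card - 1)) *
        (∏ c ∈ Finset.range k, if c ∈ S then 1 else g ^ (Finset.range (c + 1) \ S).card) *
          h (k - S.card)) = (subsetStep g)^[k] h 0 := by
  induction k generalizing h with
  | zero => simp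
  | succ k ih =>
    -- Whether the top element `k` is chosen affects only the factors at `c = k`, the sign and the
    -- argument of `h`. With `r = k - S.card`, omitting `k` gives the first term of `subsetStep`,
    -- choosing it gives the second.
    rw [Function.iterate_succ_apply, ← ih, Finset.range_add_one,
      Finset.sum_powerset_insert Finset.notMem_range_self, ← Finset.sum_add_distrib]
    refine Finset.sum_congr rfl fun S hS => ?_
    rw [Finset.mem_powerset] at hS
    have hk : k ∉ S := fun h => Finset.notMem_range_self (hS h)
    have hcard : S.card ≤ k := by simpa using Finset.card_le_card hS
    have e1 : (Finset.range (k + 1) \ S).card = k - S.card + 1 := by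
      rw [card_range_sdiff (hS.trans (Finset.range_mono (Nat.le_succ k)))]
      omega
    have e2 : (Finset.range (k + 1) \ insert k S).card = k - S.card := by
      rw [← card_range_sdiff hS]
      congr 1
      ext c
      simp only [Finset.mem_sdiff, Finset.mem_range, Finset.mem_insert]
      constructor
      · rintro ⟨h1, h2⟩
        exact ⟨by omega, by tauto⟩
      · rintro ⟨h1, h2⟩
        exact ⟨by omega, by rintro (rfl | h3); exacts [lt_irrefl _ h1, h2 h3]⟩
    have e3 : ∀ c ∈ Finset.range k,
        Finset.range (c + 1) \ insert k S = Finset.range (c + 1) \ S := fun c hc => by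
      rw [Finset.mem_range] at hc
      ext d
      simp only [Finset.mem_sdiff, Finset.mem_range, Finset.mem_insert]
      constructor
      · rintro ⟨h1, h2⟩
        exact ⟨h1, by tauto⟩
      · rintro ⟨h1, h2⟩
        exact ⟨h1, by rintro (rfl | h3); exacts [by omega, h2 h3]⟩
    have e4 : ∏ c ∈ Finset.range k, (g ^ (Finset.range (c + 1) \ insert k S).card - 1) =
        ∏ c ∈ Finset.range k, (g ^ (Finset.range (c + 1) \ S).card - 1) :=
      Finset.prod_congr rfl fun c hc => by rw [e3 c hc]
    have e5 : (∏ c ∈ Finset.range k,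
        if c ∈ insert k S then 1 else g ^ (Finset.range (c + 1) \ insert k S).card) =
        ∏ c ∈ Finset.range k, if c ∈ S then 1 else g ^ (Finset.range (c + 1) \ S).card :=
      Finset.prod_congr rfl fun c hc => by
        have : c ≠ k := (Finset.mem_range.1 hc).ne
        rw [e3 c hc]
        simp [this]
    have e6 : k + 1 - S.card = k - S.card + 1 := by omega
    have e7 : k + 1 - (S.card + 1) = k - S.card := by omega
    rw [Finset.prod_insert Finset.notMem_range_self, Finset.prod_insert Finset.notMem_range_self,
      Finset.prod_insert Finset.notMem_range_self, Finset.prod_insert Finset.notMem_range_self,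
      e4, e5, e1, e2, Finset.card_insert_of_notMem hk, e6, e7, if_neg hk,
      if_pos (Finset.mem_insert_self k S), subsetStep]
    ring

variable {g : ℤ[X]}

lemma X_pow_dvd_iterate_subsetStep (hg : ∀ r, X ∣ g ^ r - 1) (k : ℕ) (h : ℕ → ℤ[X]) (r : ℕ) :
    X ^ k ∣ (subsetStep g)^[k] h r := by
  induction k generalizing r with
  | zero => simp
  | succ k ih =>
    rw [Function.iterate_succ_apply', subsetStep, pow_succ]
    exact dvd_sub (mul_dvd_mul ((ih (r + 1)).mul_right _) (hg _)) (mul_dvd_mul (ih r) (hg _))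

lemma X_pow_dvd_prod (hg : ∀ r, X ∣ g ^ r - 1) (d : ℕ) :
    X ^ d ∣ ∏ j ∈ Finset.range d, (g ^ (j + 1) - 1) := by
  conv_lhs => rw [← Finset.card_range d, ← Finset.prod_const]
  exact Finset.prod_dvd_prod_of_dvd _ _ fun j _ => hg _

/-- The sum of all iterates of the recursion at `0`, modulo a power of `X`. -/
lemma X_pow_dvd_sum_iterate_sub (hg : ∀ r, X ∣ g ^ r - 1) (N : ℕ) (h : ℕ → ℤ[X]) :
    X ^ N ∣ ∑ k ∈ Finset.range N, (subsetStep g)^[k] h 0 -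
      ∑ r ∈ Finset.range N, (∏ j ∈ Finset.range r, (g ^ (j + 1) - 1)) * h r := by
  -- A truncated Neumann series: it solves `H = h + subsetStep g H` up to the `N`-th iterate, which
  -- `X ^ N` divides.
  let H : ℕ → ℤ[X] := fun r => ∑ k ∈ Finset.range N, (subsetStep g)^[k] h r
  have hstep : ∀ r, H r + (subsetStep g)^[N] h r = h r + subsetStep g H r := fun r => by
    have h1 := (Finset.sum_range_succ (fun k => (subsetStep g)^[k] h r) N).symm.trans
      (Finset.sum_range_succ' (fun k => (subsetStep g)^[k] h r) N)
    have h2 : subsetStep g H r = ∑ k ∈ Finset.range N, (subsetStep g)^[k + 1] h r := by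
      simp only [Function.iterate_succ_apply', subsetStep, H, Finset.sum_mul,
        Finset.sum_sub_distrib]
    rw [h2, add_comm (h r)]
    exact h1
  -- The term `-(g ^ t - 1) * H t` moves to the left and leaves `g ^ t * H t`, so the equation
  -- unrolls with one remainder. At `t = N` its product is divisible by `X ^ N`.
  have key : ∀ t, X ^ N ∣ H 0 - ∑ r ∈ Finset.range t,
      (∏ j ∈ Finset.range r, (g ^ (j + 1) - 1)) * h r -
        (∏ j ∈ Finset.range t, (g ^ (j + 1) - 1)) * (g ^ t * H t) := by
    intro t
    induction t with
    | zero => simp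
    | succ t ih =>
      have h1 := hstep t
      have h2 := (X_pow_dvd_iterate_subsetStep hg N h t).mul_left
        (∏ j ∈ Finset.range t, (g ^ (j + 1) - 1))
      rw [subsetStep] at h1
      rw [Finset.sum_range_succ, Finset.prod_range_succ]
      convert dvd_sub ih h2 using 1
      linear_combination (∏ j ∈ Finset.range t, (g ^ (j + 1) - 1)) * h1
  have h1 := key N
  have h2 := (X_pow_dvd_prod hg N).mul_right (g ^ N * H N)
  simpa using dvd_add h1 h2

end SignedSums

/-! ### Counting over all dimensions -/

section SigmaCount

/-- Counting a set of dependent pairs by its sections. -/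
lemma finite_and_ncard_sigma {α : ℕ → Type*} (S : Set (Σ m, α m)) (c : ℕ → ℕ) (N : ℕ)
    (hfin : ∀ m, {a : α m | (⟨m, a⟩ : Σ m, α m) ∈ S}.Finite)
    (hc : ∀ m, {a : α m | (⟨m, a⟩ : Σ m, α m) ∈ S}.ncard = c m)
    (h0 : ∀ m, N ≤ m → c m = 0) :
    S.Finite ∧ S.ncard = ∑ m ∈ Finset.range N, c m := by
  have hS : S = ↑((Finset.range N).sigma fun m => (hfin m).toFinset) := by
    ext ⟨m, a⟩
    simp only [Finset.coe_sigma, Set.mem_sigma_iff, Finset.coe_range, Set.mem_Iio,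
      Set.Finite.coe_toFinset]
    refine ⟨fun h => ⟨?_, h⟩, fun h => h.2⟩
    by_contra hm
    have := (Set.ncard_eq_zero (hfin m)).1 ((hc m).trans (h0 m (not_lt.1 hm)))
    exact (Set.eq_empty_iff_forall_notMem.1 this a) h
  have hcard : ((Finset.range N).sigma fun m => (hfin m).toFinset).card =
      ∑ m ∈ Finset.range N, c m := by
    rw [Finset.card_sigma]
    exact Finset.sum_congr rfl fun m _ => by rw [← hc m, Set.ncard_eq_toFinset_card _ (hfin m)]
  rw [← hcard, ← Set.ncard_coe_finset, ← hS]
  exact ⟨hS ▸ Finset.finite_toSet _, rfl⟩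

end SigmaCount

end SelfDualIntervalOrder

namespace SelfDualIntervalOrder

open Polynomial

/-! ### Row-Fishburn matrices -/

section RowFishburn

lemma entry_le_size {d : ℕ} (M : Matrix (Fin d) (Fin d) ℕ) (i j : Fin d) : M i j ≤ size M :=
  (Finset.single_le_sum (f := fun j => M i j) (fun _ _ => Nat.zero_le _)
    (Finset.mem_univ j)).trans
      (Finset.single_le_sum (f := fun i => ∑ j, M i j) (fun _ _ => Nat.zero_le _)
        (Finset.mem_univ i))

/-- Row-Fishburn matrices of dimension `d` and size `n`. -/
lemma rowFishburn_count (n d : ℕ) :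
    {M : Matrix (Fin d) (Fin d) ℕ | IsRowFishburn M ∧ size M = n}.Finite ∧
      ({M : Matrix (Fin d) (Fin d) ℕ | IsRowFishburn M ∧ size M = n}.ncard : ℤ) =
        (∏ j ∈ Finset.range d, (geom n ^ (j + 1) - 1)).coeff n := by
  have h1 := sum_families n (fun i : Fin d => Finset.Ici i) (fun _ => True)
    (fun f => ∀ i, (∀ j, j ∉ Finset.Ici i → f i j = 0) ∧ (True → f i ≠ 0)) fun _ => Iff.rfl
  have h2 : ∏ i : Fin d, (geom n ^ (Finset.Ici i).card - if True then 1 else 0) =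
      ∏ j ∈ Finset.range d, (geom n ^ (j + 1) - 1) := by
    -- Row `i` has `d - i` free cells, so the factors appear in reverse order.
    rw [← Finset.prod_range_reflect, Finset.prod_range]
    refine Finset.prod_congr rfl fun i _ => ?_
    rw [Fin.card_Ici, if_pos trivial, show d - 1 - (i : ℕ) + 1 = d - i by omega]
  rw [h2] at h1
  rw [← h1, coeff_sum_ite_X_pow]
  set s := Finset.univ.filter fun f : Fin d → Fin d → Fin (n + 1) =>
    (∀ i, (∀ j, j ∉ Finset.Ici i → f i j = 0) ∧ (True → f i ≠ 0)) ∧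
      ∑ i, ∑ j, (f i j : ℕ) = n with hs
  let φ : (Fin d → Fin d → Fin (n + 1)) → Matrix (Fin d) (Fin d) ℕ :=
    fun f => Matrix.of fun i j => (f i j : ℕ)
  have hφ : Function.Injective φ := fun f f' hff => by
    funext i j
    exact Fin.ext (congrFun (congrFun hff i) j)
  have himg : {M : Matrix (Fin d) (Fin d) ℕ | IsRowFishburn M ∧ size M = n} = φ '' ↑s := by
    ext M
    constructor
    · rintro ⟨⟨hU, hR⟩, hn⟩
      have hlt : ∀ i j, M i j < n + 1 := fun i j =>
        Nat.lt_succ_of_le (hn ▸ entry_le_size M i j)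
      refine ⟨fun i j => ⟨M i j, hlt i j⟩, ?_, rfl⟩
      simp only [hs, Finset.coe_filter, Finset.mem_univ, true_and, Set.mem_ofPred_eq]
      refine ⟨fun i => ⟨fun j hj => ?_, fun _ h0 => ?_⟩, hn⟩
      · rw [Finset.mem_Ici, not_le] at hj
        exact Fin.ext (hU i j hj)
      · obtain ⟨j, hj⟩ := hR i
        exact hj (congrArg Fin.val (congrFun h0 j))
    · rintro ⟨f, hf, rfl⟩
      simp only [hs, Finset.coe_filter, Finset.mem_univ, true_and, Set.mem_ofPred_eq] at hf
      obtain ⟨hf, hn⟩ := hf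
      refine ⟨⟨fun i j hij => ?_, fun i => ?_⟩, hn⟩
      · simp only [φ, Matrix.of_apply]
        rw [(hf i).1 j (by rwa [Finset.mem_Ici, not_le])]
        rfl
      · obtain ⟨j, hj⟩ := Function.ne_iff.1 ((hf i).2 trivial)
        exact ⟨j, fun h => hj (Fin.ext h)⟩
  rw [himg, Set.ncard_image_of_injective _ hφ, Set.ncard_coe_finset]
  exact ⟨(Finset.finite_toSet s).image φ, rfl⟩

end RowFishburn

/-! ### Self-dual Fishburn matrices through their upper halves -/

section HalfMatrices

variable {m : ℕ}

/-- The rows of the cells in column `j` that lie on or above both diagonals. -/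
def halfColumn (j : Fin m) : Finset (Fin m) :=
  Finset.univ.filter fun i => i ≤ j ∧ (i : ℕ) + j < m

/-- A filling of the upper half, given by columns, vanishes in the row `c` and in the column dual
to the row `c`. -/
def HookZero {n : ℕ} (f : Fin m → Fin m → Fin (n + 1)) (c : ℕ) : Prop :=
  ∀ j i : Fin m, ((i : ℕ) = c ∨ (j : ℕ) + c + 1 = m) → f j i = 0

instance {n : ℕ} (f : Fin m → Fin m → Fin (n + 1)) : DecidablePred (HookZero f) :=
  fun _ => inferInstanceAs (Decidable (∀ _ _, _))

/-- The fillings of the upper half that come from self-dual Fishburn matrices. -/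
def IsHalfFishburn {n : ℕ} (k e : ℕ) (f : Fin m → Fin m → Fin (n + 1)) : Prop :=
  (∀ j, (∀ i, i ∉ halfColumn j → f j i = 0) ∧ ((j : ℕ) < k + e → f j ≠ 0)) ∧
    ∀ c ∈ Finset.range k, ¬ HookZero f c

instance {n : ℕ} (k e : ℕ) :
    DecidablePred (IsHalfFishburn k e : (Fin m → Fin m → Fin (n + 1)) → Prop) :=
  fun _ => inferInstanceAs (Decidable (_ ∧ _))

/-- The part of a half column that avoids a set of hooks. -/
def halfColumnAvoiding (S : Finset ℕ) (j : Fin m) : Finset (Fin m) :=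
  (halfColumn j).filter fun i => (i : ℕ) ∉ S ∧ (j.rev : ℕ) ∉ S

/-- Such a column has the cells in rows `0, …, j`. Its dual row has index at least `k`, so only the
horizontal arms of the hooks in `S` remove cells. -/
lemma card_halfColumnAvoiding_of_lt {k e : ℕ} (he : e ≤ 1) (hm : m = k + e + k) {S : Finset ℕ}
    (hS : S ⊆ Finset.range k) {j : Fin m} (hj : (j : ℕ) < k + e) :
    (halfColumnAvoiding S j).card = (Finset.range (j + 1) \ S).card := by
  rw [← Finset.card_map Fin.valEmbedding]
  congr 1
  ext c
  simp only [halfColumnAvoiding, halfColumn, Finset.mem_map, Finset.mem_filter, Finset.mem_univ,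
    true_and, Fin.valEmbedding_apply, Finset.mem_sdiff, Finset.mem_range, Fin.le_def, Fin.val_rev]
  constructor
  · rintro ⟨i, ⟨⟨h1, h2⟩, h3, h4⟩, rfl⟩
    exact ⟨by omega, h3⟩
  · rintro ⟨h1, h2⟩
    refine ⟨⟨c, by omega⟩, ⟨⟨by simp only; omega, by simp only; omega⟩, h2, fun h => ?_⟩, rfl⟩
    have := Finset.mem_range.1 (hS h)
    omega

/-- The antidiagonal cuts this column to rows `0, …, c`. It is the vertical arm of hook `c`, hence
empty when `c ∈ S`. -/
lemma card_halfColumnAvoiding_of_ge {k e : ℕ} (hm : m = k + e + k) {S : Finset ℕ}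
    {j : Fin m} {c : ℕ} (hc : c < k) (hj : (j : ℕ) + c + 1 = m) :
    (halfColumnAvoiding S j).card = if c ∈ S then 0 else (Finset.range (c + 1) \ S).card := by
  have hrev : (j.rev : ℕ) = c := by rw [Fin.val_rev]; omega
  split_ifs with hcS
  · rw [Finset.card_eq_zero, halfColumnAvoiding, Finset.filter_eq_empty_iff]
    rintro i - ⟨-, h⟩
    exact h (hrev ▸ hcS)
  · rw [← Finset.card_map Fin.valEmbedding]
    congr 1
    ext d
    simp only [halfColumnAvoiding, halfColumn, Finset.mem_map, Finset.mem_filter, Finset.mem_univ,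
      true_and, Fin.valEmbedding_apply, Finset.mem_sdiff, Finset.mem_range, Fin.le_def, hrev]
    constructor
    · rintro ⟨i, ⟨⟨h1, h2⟩, h3, h4⟩, rfl⟩
      exact ⟨by omega, h3⟩
    · rintro ⟨h1, h2⟩
      exact ⟨⟨d, by omega⟩, ⟨⟨by simp only; omega, by simp only; omega⟩, h2, hcS⟩, rfl⟩

/-- The generating function of half fillings. -/
lemma sum_isHalfFishburn (n k e : ℕ) (he : e ≤ 1) (hm : m = k + e + k) :
    ∑ f : Fin m → Fin m → Fin (n + 1),
      (if IsHalfFishburn k e f then (X : ℤ[X]) ^ ∑ j, ∑ i, (f j i : ℕ) else 0) =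
        (subsetStep (geom n))^[k] (fun r => (geom n ^ (r + 1) - 1) ^ e) 0 := by
  rw [← sum_powerset_range_eq_iterate]
  have h1 : ∀ f : Fin m → Fin m → Fin (n + 1),
      (if IsHalfFishburn k e f then (X : ℤ[X]) ^ ∑ j, ∑ i, (f j i : ℕ) else 0) =
      ∑ S ∈ (Finset.range k).powerset, (-1) ^ S.card *
        if ∀ j, (∀ i, i ∉ halfColumnAvoiding S j → f j i = 0) ∧ ((j : ℕ) < k + e → f j ≠ 0) then
          (X : ℤ[X]) ^ ∑ j, ∑ i, (f j i : ℕ) else 0 := fun f => by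
    -- Inclusion-exclusion over the hooks forced to vanish: this merely shrinks the supports of the
    -- columns, which stay independent.
    refine (ite_forall_not_eq_sum (Finset.range k) (HookZero f)
      (∀ j, (∀ i, i ∉ halfColumn j → f j i = 0) ∧ ((j : ℕ) < k + e → f j ≠ 0)) _).trans ?_
    refine Finset.sum_congr rfl fun S hS => ?_
    congr 1
    refine if_congr ?_ rfl rfl
    constructor
    · rintro ⟨hf, hz⟩ j
      refine ⟨fun i hi => ?_, (hf j).2⟩
      simp only [halfColumnAvoiding, Finset.mem_filter, not_and_or, not_not] at hi
      rcases hi with hi | hi | hi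
      · exact (hf j).1 i hi
      · exact hz _ hi j i (Or.inl rfl)
      · exact hz _ hi j i (Or.inr (by rw [Fin.val_rev]; omega))
    · intro hf
      refine ⟨fun j => ⟨fun i hi => (hf j).1 i fun h => hi (Finset.mem_filter.1 h).1, (hf j).2⟩,
        fun c hc j i hij => (hf j).1 i fun h => ?_⟩
      have h := (Finset.mem_filter.1 h).2
      rcases hij with rfl | hij
      · exact h.1 hc
      · exact h.2 (by rwa [Fin.val_rev, show m - ((j : ℕ) + 1) = c by omega])
  rw [Finset.sum_congr rfl fun f _ => h1 f, Finset.sum_comm]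
  refine Finset.sum_congr rfl fun S hS => ?_
  rw [Finset.mem_powerset] at hS
  rw [← Finset.mul_sum, sum_families n (halfColumnAvoiding S) (fun j : Fin m => (j : ℕ) < k + e) _
    fun _ => Iff.rfl]
  congr 1
  let ρ : ℕ → ℕ := fun c => (Finset.range (c + 1) \ S).card
  let φ : ℕ → ℤ[X] := fun j => if j < k + e then geom n ^ ρ j - 1 else
    if m - 1 - j ∈ S then 1 else geom n ^ ρ (m - 1 - j)
  have h2 : ∀ j : Fin m, (geom n ^ (halfColumnAvoiding S j).card -
      if (j : ℕ) < k + e then 1 else 0) = φ j := fun j => by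
    by_cases hj : (j : ℕ) < k + e
    · simp only [φ, if_pos hj, card_halfColumnAvoiding_of_lt he hm hS hj, ρ]
    · have hj' := j.2
      simp only [φ, if_neg hj, sub_zero, ρ,
        card_halfColumnAvoiding_of_ge (S := S) (j := j) (c := m - 1 - j) hm (by omega) (by omega)]
      split_ifs <;> simp
  have h3 : ∏ x ∈ Finset.range k, φ (k + e + x) =
      ∏ c ∈ Finset.range k, if c ∈ S then 1 else geom n ^ ρ c := by
    rw [← Finset.prod_range_reflect (fun c => if c ∈ S then 1 else geom n ^ ρ c)]
    refine Finset.prod_congr rfl fun x _ => ?_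
    simp only [φ]
    rw [if_neg (by omega), show m - 1 - (k + e + x) = k - 1 - x by omega]
  have h4 : ∏ x ∈ Finset.range (k + e), φ x =
      -- The last factor is the central column, present only in odd dimension, with `k + 1 - S.card`
      -- free cells.
      (∏ c ∈ Finset.range k, (geom n ^ ρ c - 1)) * (geom n ^ (k - S.card + 1) - 1) ^ e := by
    rw [Finset.prod_congr rfl fun x hx => if_pos (Finset.mem_range.1 hx), Finset.prod_range_add]
    congr 1
    have hρ : ρ k = k - S.card + 1 := by
      have := Finset.card_le_card hS
      rw [Finset.card_range] at this
      simp only [ρ]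
      rw [card_range_sdiff (hS.trans (Finset.range_mono (Nat.le_succ k)))]
      omega
    interval_cases e
    · simp
    · simp [hρ]
  rw [Finset.prod_congr rfl fun j _ => h2 j, ← Finset.prod_range, hm, Finset.prod_range_add, h3, h4]
  ring

/-- The self-dual upper-triangular matrix with a given upper half. -/
def selfDualExtension {n : ℕ} (f : Fin m → Fin m → Fin (n + 1)) : Matrix (Fin m) (Fin m) ℕ :=
  Matrix.of fun i j => if i ≤ j then
    (if (i : ℕ) + j < m then (f j i : ℕ) else (f i.rev j.rev : ℕ)) else 0

lemma selfDualExtension_upper {n : ℕ} (f : Fin m → Fin m → Fin (n + 1)) {i j : Fin m}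
    (hij : i ≤ j) (h : (i : ℕ) + j < m) : selfDualExtension f i j = f j i := by
  rw [selfDualExtension, Matrix.of_apply, if_pos hij, if_pos h]

lemma selfDualExtension_lower {n : ℕ} (f : Fin m → Fin m → Fin (n + 1)) {i j : Fin m}
    (hij : i ≤ j) (h : ¬ (i : ℕ) + j < m) : selfDualExtension f i j = f i.rev j.rev := by
  rw [selfDualExtension, Matrix.of_apply, if_pos hij, if_neg h]

lemma isUpperTriangular_selfDualExtension {n : ℕ} (f : Fin m → Fin m → Fin (n + 1)) :
    IsUpperTriangular (selfDualExtension f) := fun i j hij => by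
  rw [selfDualExtension, Matrix.of_apply, if_neg (not_le.2 hij)]

lemma dual_selfDualExtension {n : ℕ} (f : Fin m → Fin m → Fin (n + 1)) :
    dual (selfDualExtension f) = selfDualExtension f := by
  ext i j
  simp only [dual, selfDualExtension, Matrix.of_apply, Fin.rev_le_rev, Fin.rev_rev, Fin.val_rev]
  refine if_congr Iff.rfl ?_ rfl
  have hi := i.2
  have hj := j.2
  by_cases h : (i : ℕ) + j + 1 = m
  · obtain rfl : i = j.rev := Fin.ext (by rw [Fin.val_rev]; omega)
    simp only [Fin.rev_rev]
    split_ifs <;> rfl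
  · by_cases h' : (i : ℕ) + j < m
    · rw [if_pos h', if_neg (by omega)]
    · rw [if_neg h', if_pos (by omega)]

/-- Duality carries row `j.rev` to column `j`, so the column condition is redundant. -/
lemma IsUpperTriangular.isFishburn_iff {M : Matrix (Fin m) (Fin m) ℕ} (hM : IsUpperTriangular M)
    (hd : dual M = M) : IsFishburn M ↔ ∀ i, ∃ j, M i j ≠ 0 := by
  refine ⟨fun h => h.2.1, fun h => ⟨hM, h, fun j => ?_⟩⟩
  obtain ⟨i, hi⟩ := h j.rev
  refine ⟨i.rev, ?_⟩
  rw [← hd]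
  simpa only [dual, Matrix.of_apply, Fin.rev_rev] using hi

/-- Row `r` of the extension is made of row `r` of the half and the reflection of column `r.rev`.
For `r ≥ k` the former has at most the central cell, which lies in that column, so the column must
be nonzero; for `r < k` the two together are hook `r`. -/
lemma isFishburn_selfDualExtension_iff {n k e : ℕ} (he : e ≤ 1) (hm : m = k + e + k)
    {f : Fin m → Fin m → Fin (n + 1)} (hf : ∀ j i, i ∉ halfColumn j → f j i = 0) :
    IsFishburn (selfDualExtension f) ↔ IsHalfFishburn k e f := by
  have hsupp : ∀ {j i : Fin m}, f j i ≠ 0 → i ≤ j ∧ (i : ℕ) + j < m := fun {j i} h => by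
    by_contra hn
    exact h (hf j i fun hmem => hn (Finset.mem_filter.1 hmem).2)
  have hval : ∀ {j i : Fin m}, (f j i : ℕ) ≠ 0 ↔ f j i ≠ 0 := fun {j i} => by
    rw [Ne, Ne, Fin.ext_iff]; rfl
  have hrow : ∀ r : Fin m, (∃ j, selfDualExtension f r j ≠ 0) ↔
      (∃ j, f j r ≠ 0) ∨ ∃ i, f r.rev i ≠ 0 := fun r => by
    constructor
    · rintro ⟨j, hj⟩
      by_cases hrj : r ≤ j
      · by_cases h : (r : ℕ) + j < m
        · rw [selfDualExtension_upper f hrj h] at hj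
          exact Or.inl ⟨j, hval.1 hj⟩
        · rw [selfDualExtension_lower f hrj h] at hj
          exact Or.inr ⟨_, hval.1 hj⟩
      · exact absurd (isUpperTriangular_selfDualExtension f r j (not_le.1 hrj)) hj
    · have hleft : (∃ j, f j r ≠ 0) → ∃ j, selfDualExtension f r j ≠ 0 := by
        rintro ⟨j, hj⟩
        obtain ⟨h1, h2⟩ := hsupp hj
        refine ⟨j, ?_⟩
        rw [selfDualExtension_upper f h1 h2]
        exact hval.2 hj
      rintro (h | ⟨i, hi⟩)
      · exact hleft h
      · obtain ⟨h1, h2⟩ := hsupp hi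
        rw [Fin.le_def, Fin.val_rev] at h1
        rw [Fin.val_rev] at h2
        -- An antidiagonal cell is its own reflection and already lies in row `r`.
        by_cases hir : i = r
        · exact hleft ⟨r.rev, hir ▸ hi⟩
        · have hir' : (i : ℕ) ≠ r := fun h => hir (Fin.ext h)
          refine ⟨i.rev, ?_⟩
          rw [selfDualExtension_lower f (by rw [Fin.le_def, Fin.val_rev]; omega)
            (by rw [Fin.val_rev]; omega), Fin.rev_rev]
          exact hval.2 hi
  rw [(isUpperTriangular_selfDualExtension f).isFishburn_iff (dual_selfDualExtension f)]
  simp only [hrow]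
  constructor
  · refine fun h => ⟨fun j => ⟨hf j, fun hj => ?_⟩, fun c hc hz => ?_⟩
    · rw [Function.ne_iff]
      rcases h j.rev with ⟨j', hj'⟩ | ⟨i, hi⟩
      · obtain ⟨h1, h2⟩ := hsupp hj'
        rw [Fin.le_def, Fin.val_rev] at h1
        rw [Fin.val_rev] at h2
        have hj2 := j.2
        obtain rfl : j = j' := Fin.ext (by omega)
        exact ⟨_, hj'⟩
      · rw [Fin.rev_rev] at hi
        exact ⟨i, hi⟩
    · rw [Finset.mem_range] at hc
      rcases h ⟨c, by omega⟩ with ⟨j, hj⟩ | ⟨i, hi⟩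
      · exact hj (hz _ _ (Or.inl rfl))
      · exact hi (hz _ _ (Or.inr (by rw [Fin.val_rev]; simp only; omega)))
  · rintro ⟨h1, h2⟩ r
    by_cases hr : (r : ℕ) < k
    · have h3 := h2 r (Finset.mem_range.2 hr)
      simp only [HookZero, not_forall] at h3
      obtain ⟨j, i, h4 | h4, h5⟩ := h3
      · exact Or.inl ⟨j, Fin.ext h4 ▸ h5⟩
      · have : r.rev = j := Fin.ext (by rw [Fin.val_rev]; omega)
        exact Or.inr ⟨i, this ▸ h5⟩
    · exact Or.inr (Function.ne_iff.1 ((h1 r.rev).2 (by rw [Fin.val_rev]; omega)))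

lemma reducedSize_selfDualExtension {n : ℕ} {f : Fin m → Fin m → Fin (n + 1)}
    (hf : ∀ j i, i ∉ halfColumn j → f j i = 0) :
    reducedSize (selfDualExtension f) = ∑ j, ∑ i, (f j i : ℕ) := by
  rw [reducedSize, Finset.sum_comm]
  refine Finset.sum_congr rfl fun j _ => Finset.sum_congr rfl fun i _ => ?_
  by_cases hi : i ∈ halfColumn j
  · have h := (Finset.mem_filter.1 hi).2
    rw [if_pos (by omega), selfDualExtension_upper f h.1 h.2]
  · rw [hf j i hi]
    split_ifs with h
    · by_cases hij : i ≤ j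
      · exact absurd (Finset.mem_filter.2 ⟨Finset.mem_univ i, hij, by omega⟩) hi
      · exact isUpperTriangular_selfDualExtension f i j (not_le.1 hij)
    · rfl

lemma entry_le_reducedSize (M : Matrix (Fin m) (Fin m) ℕ) {i j : Fin m} (h : (i : ℕ) + j < m) :
    M i j ≤ reducedSize M := by
  have h1 : M i j = if ((i : ℕ) + 1) + ((j : ℕ) + 1) ≤ m + 1 then M i j else 0 := by
    rw [if_pos (by omega)]
  rw [h1]
  exact (Finset.single_le_sum
    (f := fun j : Fin m => if ((i : ℕ) + 1) + ((j : ℕ) + 1) ≤ m + 1 then M i j else 0)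
    (fun _ _ => Nat.zero_le _) (Finset.mem_univ j)).trans
      (Finset.single_le_sum
        (f := fun i : Fin m =>
          ∑ j : Fin m, if ((i : ℕ) + 1) + ((j : ℕ) + 1) ≤ m + 1 then M i j else 0)
        (fun _ _ => Nat.zero_le _) (Finset.mem_univ i))

/-- Self-dual Fishburn matrices of dimension `2 k + e` and reduced size `n`. -/
lemma selfDualFishburn_count (n k e : ℕ) (he : e ≤ 1) (hm : m = k + e + k) :
    {M : Matrix (Fin m) (Fin m) ℕ | IsFishburn M ∧ dual M = M ∧ reducedSize M = n}.Finite ∧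
      ({M : Matrix (Fin m) (Fin m) ℕ |
        IsFishburn M ∧ dual M = M ∧ reducedSize M = n}.ncard : ℤ) =
        ((subsetStep (geom n))^[k] (fun r => (geom n ^ (r + 1) - 1) ^ e) 0).coeff n := by
  rw [← sum_isHalfFishburn n k e he hm, coeff_sum_ite_X_pow]
  set s := Finset.univ.filter fun f : Fin m → Fin m → Fin (n + 1) =>
    IsHalfFishburn k e f ∧ ∑ j, ∑ i, (f j i : ℕ) = n with hs
  have hmem : ∀ {f}, f ∈ s ↔ IsHalfFishburn k e f ∧ ∑ j, ∑ i, (f j i : ℕ) = n := fun {f} => by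
    simp only [hs, Finset.mem_filter, Finset.mem_univ, true_and]
  have hinj : Set.InjOn selfDualExtension (s : Set (Fin m → Fin m → Fin (n + 1))) := fun f hf f' hf' hff => by
    have hf := (hmem.1 hf).1.1
    have hf' := (hmem.1 hf').1.1
    funext j i
    by_cases hi : i ∈ halfColumn j
    · have h := (Finset.mem_filter.1 hi).2
      refine Fin.ext ?_
      rw [← selfDualExtension_upper f h.1 h.2, hff, selfDualExtension_upper f' h.1 h.2]
    · rw [(hf j).1 i hi, (hf' j).1 i hi]
  have himg : {M : Matrix (Fin m) (Fin m) ℕ | IsFishburn M ∧ dual M = M ∧ reducedSize M = n} =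
      selfDualExtension '' (s : Set (Fin m → Fin m → Fin (n + 1))) := by
    ext M
    constructor
    · rintro ⟨hF, hd, hn⟩
      let f : Fin m → Fin m → Fin (n + 1) := fun j i =>
        if h : i ≤ j ∧ (i : ℕ) + j < m then
          ⟨M i j, Nat.lt_succ_of_le (hn ▸ entry_le_reducedSize M h.2)⟩ else 0
      have hf : ∀ j i, i ∉ halfColumn j → f j i = 0 := fun j i hi =>
        dif_neg fun h => hi (Finset.mem_filter.2 ⟨Finset.mem_univ i, h⟩)
      have hval : ∀ {i j : Fin m}, i ≤ j → (i : ℕ) + j < m → (f j i : ℕ) = M i j :=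
        fun {i j} h1 h2 => by simp only [f, dif_pos (And.intro h1 h2)]
      have hM : selfDualExtension f = M := by
        ext i j
        by_cases hij : i ≤ j
        · by_cases h : (i : ℕ) + j < m
          · rw [selfDualExtension_upper f hij h, hval hij h]
          · rw [selfDualExtension_lower f hij h, hval (Fin.rev_le_rev.2 hij)
              (by rw [Fin.val_rev, Fin.val_rev]; omega)]
            exact congrFun (congrFun hd i) j
        · rw [hF.1 i j (not_le.1 hij),
            isUpperTriangular_selfDualExtension f i j (not_le.1 hij)]
      refine ⟨f, hmem.2 ⟨?_, ?_⟩, hM⟩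
      · rwa [← isFishburn_selfDualExtension_iff he hm hf, hM]
      · rw [← reducedSize_selfDualExtension hf, hM, hn]
    · rintro ⟨f, hf, rfl⟩
      obtain ⟨hf, hn⟩ := hmem.1 hf
      have hf0 : ∀ j i, i ∉ halfColumn j → f j i = 0 := fun j => (hf.1 j).1
      exact ⟨(isFishburn_selfDualExtension_iff he hm hf0).2 hf, dual_selfDualExtension f,
        (reducedSize_selfDualExtension hf0).trans hn⟩
  rw [himg, hinj.ncard_image, Set.ncard_coe_finset]
  exact ⟨(Finset.finite_toSet s).image _, rfl⟩

end HalfMatrices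

/-! ### Summation over all dimensions -/

section Total

lemma coeff_eq_zero_of_X_pow_dvd {p : ℤ[X]} {n N : ℕ} (h : X ^ N ∣ p) (hn : n < N) :
    p.coeff n = 0 :=
  X_pow_dvd_iff.1 h n hn

lemma rowFishburnMatrices_count (n : ℕ) :
    (rowFishburnMatrices n).Finite ∧ ((rowFishburnMatrices n).ncard : ℤ) =
      (∑ d ∈ Finset.range (n + 1), ∏ j ∈ Finset.range d, (geom n ^ (j + 1) - 1)).coeff n := by
  obtain ⟨h1, h2⟩ := finite_and_ncard_sigma (rowFishburnMatrices n)
    (fun d => {M : Matrix (Fin d) (Fin d) ℕ | IsRowFishburn M ∧ size M = n}.ncard) (n + 1)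
    (fun d => (rowFishburn_count n d).1) (fun d => rfl) (fun d hd => by
      have := (rowFishburn_count n d).2
      rw [coeff_eq_zero_of_X_pow_dvd (X_pow_dvd_prod (X_dvd_geom_pow_sub_one n) d) hd] at this
      exact_mod_cast this)
  refine ⟨h1, ?_⟩
  rw [h2, Nat.cast_sum, finsetSum_coeff]
  exact Finset.sum_congr rfl fun d _ => (rowFishburn_count n d).2

lemma sum_range_two_mul (c : ℕ → ℕ) (N : ℕ) :
    ∑ m ∈ Finset.range (2 * N), c m = ∑ k ∈ Finset.range N, (c (k + k) + c (k + 1 + k)) := by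
  induction N with
  | zero => simp
  | succ N ih =>
    rw [Finset.sum_range_succ, ← ih, mul_add, mul_one, Finset.sum_range_succ,
      Finset.sum_range_succ, ← two_mul, show N + 1 + N = 2 * N + 1 by omega, add_assoc]

lemma selfDualFishburnMatrices_count (n : ℕ) (hn : 1 ≤ n) :
    (selfDualFishburnMatrices n).Finite ∧
      (selfDualFishburnMatrices n).ncard = 2 * (rowFishburnMatrices n).ncard := by
  set g := geom n
  have hg : ∀ r, X ∣ g ^ r - 1 := X_dvd_geom_pow_sub_one n
  let p : ℕ → ℤ[X] := fun d => ∏ j ∈ Finset.range d, (g ^ (j + 1) - 1)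
  let F : ℕ → ℕ → ℤ[X] := fun e k => (subsetStep g)^[k] (fun r => (g ^ (r + 1) - 1) ^ e) 0
  let c : ℕ → ℕ := fun m =>
    {M : Matrix (Fin m) (Fin m) ℕ | IsFishburn M ∧ dual M = M ∧ reducedSize M = n}.ncard
  have hpar : ∀ m : ℕ, ∃ k e, e ≤ 1 ∧ m = k + e + k := fun m => ⟨m / 2, m % 2, by omega, by omega⟩
  -- From dimension `2 * (n + 1)` on, `k ≥ n + 1`, and `X ^ k` kills the coefficient of `X ^ n`.
  obtain ⟨h1, h2⟩ := finite_and_ncard_sigma (selfDualFishburnMatrices n) c (2 * (n + 1))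
    (fun m => by
      obtain ⟨k, e, he, hm⟩ := hpar m
      exact (selfDualFishburn_count n k e he hm).1) (fun m => rfl) (fun m hle => by
      obtain ⟨k, e, he, hm⟩ := hpar m
      have := (selfDualFishburn_count n k e he hm).2
      rw [coeff_eq_zero_of_X_pow_dvd (X_pow_dvd_iterate_subsetStep hg k _ 0) (by omega)] at this
      exact_mod_cast this)
  have hF : ∀ e, (∑ k ∈ Finset.range (n + 1), F e k).coeff n =
      (∑ r ∈ Finset.range (n + 1), p r * (g ^ (r + 1) - 1) ^ e).coeff n := fun e => by
    have := coeff_eq_zero_of_X_pow_dvd (X_pow_dvd_sum_iterate_sub hg (n + 1)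
      (fun r => (g ^ (r + 1) - 1) ^ e)) (Nat.lt_succ_self n)
    rwa [coeff_sub, sub_eq_zero] at this
  have heven : (∑ r ∈ Finset.range (n + 1), p r * (g ^ (r + 1) - 1) ^ 0).coeff n =
      ((rowFishburnMatrices n).ncard : ℤ) := by
    rw [(rowFishburnMatrices_count n).2]
    simp only [pow_zero, mul_one]
    rfl
  have hodd : (∑ r ∈ Finset.range (n + 1), p r * (g ^ (r + 1) - 1) ^ 1).coeff n =
      ((rowFishburnMatrices n).ncard : ℤ) := by
    -- The central column supplies the next factor, so the odd sum is the even one shifted by one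
    -- index. The new term `p (n + 1)` has too high an order, and the lost term `p 0 = 1` has no `X
    -- ^ n` coefficient because `n ≥ 1`.
    have h3 : ∀ r, p r * (g ^ (r + 1) - 1) ^ 1 = p (r + 1) := fun r => by
      rw [pow_one]
      exact (Finset.prod_range_succ _ _).symm
    have h4 := (Finset.sum_range_succ p (n + 1)).symm.trans (Finset.sum_range_succ' p (n + 1))
    have h5 : (p (n + 1)).coeff n = 0 :=
      coeff_eq_zero_of_X_pow_dvd (X_pow_dvd_prod hg (n + 1)) (Nat.lt_succ_self n)
    have h6 : (p 0).coeff n = 0 := by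
      simp only [p, Finset.range_zero, Finset.prod_empty, coeff_one]
      rw [if_neg (by omega)]
    have h7 := congrArg (fun q => coeff q n) h4
    simp only [coeff_add, h5, h6, add_zero] at h7
    rw [Finset.sum_congr rfl fun r _ => h3 r, ← h7, (rowFishburnMatrices_count n).2]
  refine ⟨h1, ?_⟩
  have hc : ((selfDualFishburnMatrices n).ncard : ℤ) =
      (∑ k ∈ Finset.range (n + 1), F 0 k).coeff n +
        (∑ k ∈ Finset.range (n + 1), F 1 k).coeff n := by
    rw [h2, sum_range_two_mul, finsetSum_coeff, finsetSum_coeff, ← Finset.sum_add_distrib]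
    push_cast
    refine Finset.sum_congr rfl fun k _ => ?_
    rw [← (selfDualFishburn_count n k 0 zero_le_one (m := k + k) rfl).2,
      ← (selfDualFishburn_count n k 1 le_rfl (m := k + 1 + k) rfl).2]
  rw [hF, hF, heven, hodd, ← two_mul] at hc
  exact_mod_cast hc

end Total

end SelfDualIntervalOrder

theorem mainTheorem4 (n : ℕ) (hn : 1 ≤ n) :
    (SelfDualIntervalOrder.selfDualIntervalOrders n).Finite ∧
    (SelfDualIntervalOrder.selfDualFishburnMatrices n).Finite ∧
    (SelfDualIntervalOrder.rowFishburnMatrices n).Finite ∧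
    (SelfDualIntervalOrder.selfDualIntervalOrders n).ncard =
      (SelfDualIntervalOrder.selfDualFishburnMatrices n).ncard ∧
    (SelfDualIntervalOrder.selfDualFishburnMatrices n).ncard =
      2 * (SelfDualIntervalOrder.rowFishburnMatrices n).ncard := by
  obtain ⟨h1, h2⟩ := SelfDualIntervalOrder.selfDualFishburnMatrices_count n hn
  rw [SelfDualIntervalOrder.selfDualIntervalOrders_eq_image]
  refine ⟨h1.image _, h1, (SelfDualIntervalOrder.rowFishburnMatrices_count n).1, ?_, h2⟩
  exact (SelfDualIntervalOrder.injOn_matrixOrderClass.mono fun M hM => hM.1).ncard_image
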